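/- Let $R$ be a unital ring, not necessarily associative, with commutator $[x,y]=xy-yx$ and associator $(x,y,z)=(xy)z-x(yz)$. Suppose that $R$ is alternative ($(x,x,y)=0=(y,x,x)$ for all $x,y\in R$), $2$- and $3$-torsion free ($2x=0\Rightarrow x=0$ and $3x=0\Rightarrow x=0$), and prime ($AB\neq 0$ for any two nonzero two-sided ideals $A,B$ of $R$). Let $\mathcal Z(R)$ be the center of $R$, i.e. the set of $z\in R$ with $[z,x]=0$ and $(x,y,z)=(x,z,y)=(z,x,y)=0$ for all $x,y\in R$, and suppose that $zR=R$ for every nonzero $z\in\mathcal Z(R)$. Let $e_1\in R$ be a nontrivial idempotent ($e_1^2=e_1$, $e_1\ne 0,1$), put $e_2=1-e_1$ and $R_{ii}=e_iRe_i$ for $i=1,2$. Let $D\colon R\to R$ be a Lie multiplicative derivation, i.e. a map, not assumed additive, such that $D([x,y])=[D(x),y]+[x,D(y)]$ for all $x,y\in R$. Then $D=\delta+\tau$ for some additive derivation $\delta$ of $R$ (an additive map $\delta\colon R\to R$ with $\delta(xy)=\delta(x)y+x\delta(y)$ for all $x,y$) and some map $\tau\colon R\to\mathcal Z(R)$, not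 assumed additive, with $\tau([x,y])=0$ for all $x,y\in R$, if and only if a) $e_2D(R_{11})e_2\subseteq \mathcal Z(R)e_2$, and b) $e_1D(R_{22})e_1\subseteq \mathcal Z(R)e_1$. -/

import Mathlib

namespace AltRing

variable {R : Type*} [NonAssocRing R]

/-- A ring is alternative if `(x, x, y) = 0 = (y, x, x)` for all `x, y`. -/
def IsAlternative (R : Type*) [NonAssocRing R] : Prop :=
  ∀ x y : R, associator x x y = 0 ∧ associator y x x = 0

/-- `k`-torsion freeness: `k x = 0` implies `x = 0`. -/
def TorsionFreeBy (k : ℕ) (R : Type*) [NonAssocRing R] : Prop :=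
  ∀ x : R, k • x = 0 → x = 0

/-- A ring is prime if `A B ≠ 0` for any two nonzero (two-sided) ideals `A`, `B`, that is,
some product `a * b` with `a ∈ A` and `b ∈ B` is nonzero. -/
def IsPrime (R : Type*) [NonAssocRing R] : Prop :=
  ∀ A B : TwoSidedIdeal R, A ≠ ⊥ → B ≠ ⊥ → ∃ a ∈ A, ∃ b ∈ B, a * b ≠ 0

/-- An idempotent different from `0` and `1`. -/
def IsNontrivialIdempotent (e : R) : Prop :=
  e * e = e ∧ e ≠ 0 ∧ e ≠ 1

/-- The center of a non-associative ring: elements of the nucleus which commute with everything.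
This is the carrier of Mathlib's `Set.center`; see `mem_center_iff`. -/
abbrev center (R : Type*) [NonAssocRing R] : Set R := Set.center R

theorem mem_center_iff (z : R) : z ∈ center R ↔
    (∀ x y : R, associator x y z = 0 ∧ associator x z y = 0 ∧ associator z x y = 0) ∧
      ∀ x : R, ⁅z, x⁆ = 0 := by
  constructor
  · intro h
    have h' : IsMulCentral z := h
    refine ⟨fun x y => ⟨?_, ?_, ?_⟩, fun x => ?_⟩
    · simp [associator, h'.right_assoc]
    · simp [associator, h'.mid_assoc]
    · simp [associator, h'.left_assoc]
    · simp [Ring.lie_def, (h'.comm x).eq]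
  · rintro ⟨h, hc⟩
    exact (show IsMulCentral z from
      ⟨fun x => sub_eq_zero.mp (hc x), fun x y => (sub_eq_zero.mp (h x y).2.2).symm,
        fun x y => sub_eq_zero.mp (h x y).1⟩)

/-- The Peirce component `e R f`. -/
def peirce (e f : R) : Set R := {x | ∃ a : R, x = (e * a) * f}

/-- A Lie multiplicative derivation: a map, not assumed additive, with
`D [x, y] = [D x, y] + [x, D y]`, where `⁅x, y⁆ = x * y - y * x`. -/
def IsLieMulDerivation (D : R → R) : Prop :=
  ∀ x y : R, D ⁅x, y⁆ = ⁅D x, y⁆ + ⁅x, D y⁆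

/-- `D = δ + τ` with `δ` an additive derivation and `τ` a map into the center which
sends every commutator to zero. -/
def IsDerivationPlusCentral (D : R → R) : Prop :=
  ∃ (δ : R →+ R) (τ : R → R),
    (∀ x y, δ (x * y) = δ x * y + x * δ y) ∧
    (∀ x, τ x ∈ center R) ∧
    (∀ x y : R, τ ⁅x, y⁆ = 0) ∧
    ∀ x, D x = δ x + τ x

end AltRing

/-!
Write `R = R₁₁ + R₁₂ + R₂₁ + R₂₂` for the Peirce decomposition with respect to `e = e₁` and
`f = e₂`, and `Z` for the center.

A derivation maps `R₁₁` to elements without `R₂₂` component, so conditions a) and b) are necessary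
(`IsDerivationPlusCentral.component`).

For the converse, two structural facts about a prime alternative ring are needed. First, `R₁₁`
acts faithfully on `R₁₂` (`PeircePair.diag_eq_zero`): the annihilator of `R₁₂` in `R₁₁` lies in an
ideal which annihilates the ideal generated by `R₁₂` and `R₂₁`, and the latter is nonzero. Second,
a diagonal element commuting with `R₁₂` and `R₂₁` is central (`PrimePeirce.mem_center_of_diag`):
by the first fact it commutes with everything, and without `3`-torsion this suffices.

Comparing components in `D x = ⁅D e, x⁆ + ⁅e, D x⁆` for `x` in `R₁₂` or `R₂₁` shows that the
diagonal part of `D e` is central. The off-diagonal part `s` of `D e` is the value at `e` of the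
inner derivation `x ↦ ⁅⁅s, e⁆, x⁆ - 3 (s, e, x)` (`innerMap`), so that after a subtraction `D e`
is central (`PrimePeirce.exists_sub_derivation`). Then `D` commutes with `⁅e, ·⁆` and preserves
`R₁₂`, `R₂₁` and `R₁₁ + R₂₂`. The deviation `Δ(x, y) = D (x + y) - D x - D y` satisfies
`⁅Δ(x, y), t⁆ = Δ(⁅x, t⁆, ⁅y, t⁆)`; playing this against the Peirce grading shows that `D` is
additive on `R₁₂ + R₂₁` and additive modulo `Z` on all of `R` (`LiePeirce.deviation_mem_center`).

Conditions a) and b) say that `D` maps `Rᵢᵢ` to `Rᵢᵢ + Z`. As `Rᵢᵢ ∩ Z = 0`, removing the central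
part leaves an additive map `δ` which preserves all Peirce components and agrees with `D` modulo
`Z` (`LiePeirce.exists_gradedPart`). That `δ` is a derivation is checked on pairs of Peirce
components; the delicate pair is `R₁₂`, `R₂₁` (`GradedPart.map_off_mul_off_rev`), where
divisibility by central elements enters. The difference `D - δ` is central and vanishes on
commutators because `δ` is a derivation.
-/

namespace AltRing

variable {R : Type*} [NonAssocRing R]

/-! ### Identities in alternative rings -/

theorem IsAlternative.swap_left (h : IsAlternative R) (x y z : R) :
    associator x y z = -associator y x z := by
  have h1 := (h (x + y) z).1
  have h2 := (h x z).1
  have h3 := (h y z).1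
  simp only [associator, mul_add, add_mul] at *
  grind

theorem IsAlternative.swap_right (h : IsAlternative R) (x y z : R) :
    associator x y z = -associator x z y := by
  have h1 := (h (y + z) x).2
  have h2 := (h y x).2
  have h3 := (h z x).2
  simp only [associator, mul_add, add_mul] at *
  grind

theorem IsAlternative.cycle (h : IsAlternative R) (x y z : R) :
    associator x y z = associator y z x := by
  rw [h.swap_left x y z, h.swap_right y x z, neg_neg]

theorem IsAlternative.swap_outer (h : IsAlternative R) (x y z : R) :
    associator x y z = -associator z y x := by
  rw [h.cycle x y z, h.swap_left y z x]

theorem IsAlternative.flexible (h : IsAlternative R) (x y : R) : associator x y x = 0 := by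
  rw [h.swap_left, (h x y).2, neg_zero]

/-- The Kleinfeld function `(wx, y, z) - x (w, y, z) - (x, y, z) w`. In an alternative ring it is an
alternating function of its four arguments, see `IsAlternative.kleinfeld_cycle` and
`IsAlternative.kleinfeld_swap`. -/
def kleinfeld (w x y z : R) : R :=
  associator (w * x) y z - x * associator w y z - associator x y z * w

/-- The Teichmüller identity, valid in every nonassociative ring. -/
theorem teichmueller (w x y z : R) :
    associator (w * x) y z - associator w (x * y) z + associator w x (y * z) =
      w * associator x y z + associator w x y * z := by
  simp only [associator, mul_sub, sub_mul]
  abel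

/-- The cyclically alternating sum of commutators of one argument with the associator of the others.
In an alternative ring it is three times the Kleinfeld function. -/
def commSum (w x y z : R) : R :=
  ⁅w, associator x y z⁆ - ⁅x, associator y z w⁆ + ⁅y, associator z w x⁆ - ⁅z, associator w x y⁆

theorem IsAlternative.kleinfeld_sum (h : IsAlternative R) (w x y z : R) :
    kleinfeld w x y z - kleinfeld x y z w + kleinfeld y z w x = commSum w x y z := by
  have t := teichmueller w x y z
  rw [h.cycle w (x * y) z, ← h.cycle (y * z) w x] at t
  simp only [kleinfeld, commSum, Ring.lie_def]
  rw [h.cycle w y z, h.cycle x z w, h.cycle y w x]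
  grind

theorem commSum_cycle (w x y z : R) :
    commSum x y z w = -commSum w x y z := by
  simp only [commSum]
  abel

theorem IsAlternative.kleinfeld_cycle (h : IsAlternative R) (w x y z : R) :
    kleinfeld x y z w = -kleinfeld w x y z := by
  have h1 := h.kleinfeld_sum w x y z
  have h2 := h.kleinfeld_sum x y z w
  have h3 := h.kleinfeld_sum y z w x
  have h4 := commSum_cycle w x y z
  have h5 := commSum_cycle x y z w
  grind

theorem IsAlternative.kleinfeld_swap (h : IsAlternative R) (w x y z : R) :
    kleinfeld x w y z = -kleinfeld w x y z := by
  have h1 := h.kleinfeld_cycle w x y z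
  have h2 := h.kleinfeld_cycle x y z w
  have h3 := h.kleinfeld_cycle x w y z
  have h4 := h.kleinfeld_cycle w y z x
  have h5 : kleinfeld y z w x = -kleinfeld y z x w := by
    simp only [kleinfeld]
    rw [h.swap_right (y * z) w x, h.swap_right y w x, h.swap_right z w x]
    simp only [mul_neg, neg_mul]
    abel
  grind

/-- The inner map `x ↦ [[a, b], x] - 3 (a, b, x)`, an additive derivation of an alternative
ring. -/
def innerMap (a b : R) : R →+ R where
  toFun x := ⁅⁅a, b⁆, x⁆ - (3 : ℕ) • associator a b x
  map_zero' := by simp [associator, Ring.lie_def]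
  map_add' x y := by
    simp only [Ring.lie_def, associator, mul_add, add_mul]
    abel

theorem innerMap_apply (a b x : R) :
    innerMap a b x = ⁅⁅a, b⁆, x⁆ - (3 : ℕ) • associator a b x := rfl

theorem IsAlternative.lie_mul_eq (h : IsAlternative R) (c x y : R) :
    ⁅c, x * y⁆ = ⁅c, x⁆ * y + x * ⁅c, y⁆ - (3 : ℕ) • associator c x y := by
  have h1 := h.swap_left x c y
  have h2 := h.cycle c x y
  simp only [Ring.lie_def, associator, sub_mul, mul_sub] at *
  grind

/-- The failure of `(a, b, ·)` to be a derivation is measured by the associator with `⁅a, b⁆`. -/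
theorem IsAlternative.associator_mul (h : IsAlternative R) (a b x y : R) :
    associator a b (x * y) =
      associator a b x * y + x * associator a b y - associator ⁅a, b⁆ x y := by
  have s1 := h.kleinfeld_swap x y a b
  have s2 := h.kleinfeld_swap a b x y
  have s3 := h.kleinfeld_cycle x y a b
  have s4 := h.kleinfeld_cycle y a b x
  have s5 := h.kleinfeld_sum x y a b
  have hl : associator ⁅a, b⁆ x y = associator (a * b) x y - associator (b * a) x y := by
    simp only [Ring.lie_def, associator, sub_mul]
    abel
  rw [hl, ← h.cycle (x * y) a b, ← h.cycle x a b, ← h.cycle y a b]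
  simp only [kleinfeld, commSum, Ring.lie_def] at *
  rw [h.swap_left y b x] at s3 s4 s5
  rw [h.swap_right b x y] at s2 s4 s5
  rw [← h.cycle a x y, ← h.cycle x a b] at s5
  rw [← h.cycle x a b] at s3 s4
  simp only [mul_neg, neg_mul] at s2 s3 s4 s5
  grind

theorem IsAlternative.innerMap_mul (h : IsAlternative R) (a b x y : R) :
    innerMap a b (x * y) = innerMap a b x * y + x * innerMap a b y := by
  simp only [innerMap_apply, h.lie_mul_eq, h.associator_mul a b x y, sub_mul, mul_sub, smul_sub,
    smul_add, smul_mul_assoc, mul_smul_comm]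
  abel

/-- In the absence of `3`-torsion, an element commuting with everything lies in the nucleus: for
such `z`, `IsAlternative.lie_mul_eq` reads `0 = -3 (z, x, y)`. -/
theorem IsAlternative.mem_center_of_commute (h : IsAlternative R) (h3 : TorsionFreeBy 3 R)
    {z : R} (hz : ∀ x : R, ⁅z, x⁆ = 0) : z ∈ center R := by
  have key (x y : R) : associator z x y = 0 := by
    apply h3
    have := h.lie_mul_eq z x y
    rwa [hz, hz, hz, zero_mul, mul_zero, zero_add, zero_sub, eq_comm, neg_eq_zero] at this
  rw [mem_center_iff]
  refine ⟨fun x y => ⟨?_, ?_, key x y⟩, hz⟩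
  · rw [← h.cycle z x y, key]
  · rw [h.swap_left, key, neg_zero]

/-! ### The Peirce decomposition -/

/-- Complementary idempotents `e + f = 1` in a `2`-torsion free alternative ring. -/
structure PeircePair (e f : R) : Prop where
  alt : IsAlternative R
  two : TorsionFreeBy 2 R
  idem : e * e = e
  add : e + f = 1

/-- `x` lies in the Peirce component `p R q`, expressed by the action of the idempotents
`p` and `q` on `x`. -/
structure InPeirce (p q x : R) : Prop where
  left : p * x = x
  right : x * q = x

theorem InPeirce.zero {p q : R} : InPeirce p q 0 :=
  ⟨mul_zero _, zero_mul _⟩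

theorem InPeirce.add {p q x y : R} (hx : InPeirce p q x) (hy : InPeirce p q y) :
    InPeirce p q (x + y) :=
  ⟨by rw [mul_add, hx.left, hy.left], by rw [add_mul, hx.right, hy.right]⟩

theorem InPeirce.neg {p q x : R} (hx : InPeirce p q x) :
    InPeirce p q (-x) :=
  ⟨by rw [mul_neg, hx.left], by rw [neg_mul, hx.right]⟩

namespace PeircePair

variable {e f : R} (h : PeircePair e f)
include h

theorem compl : f = 1 - e := eq_sub_of_add_eq' h.add

theorem symm : PeircePair f e where
  alt := h.alt
  two := h.two
  idem := by rw [h.compl, mul_sub, sub_mul, sub_mul, h.idem]; simp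
  add := by rw [add_comm, h.add]

theorem left_zero {q x : R} (hx : InPeirce e q x) : f * x = 0 := by
  rw [h.compl, sub_mul, one_mul, hx.left, sub_self]

theorem right_zero {q x : R} (hx : InPeirce q e x) : x * f = 0 := by
  rw [h.compl, mul_sub, mul_one, hx.right, sub_self]

theorem left_one {x : R} (hx : f * x = 0) : e * x = x := by
  rw [h.compl, sub_mul, one_mul, sub_eq_zero] at hx
  exact hx.symm

theorem right_one {x : R} (hx : x * f = 0) : x * e = x := by
  rw [h.compl, mul_sub, mul_one, sub_eq_zero] at hx
  exact hx.symm

theorem idem_mul_mul (x y : R) : e * (x * y) = e * x * y + x * e * y - x * (e * y) := by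
  have := h.alt.swap_left e x y
  simp only [associator] at this
  grind

theorem mul_mul_idem (x y : R) : x * y * e = x * (y * e) - x * e * y + x * (e * y) := by
  have := h.alt.swap_right x e y
  simp only [associator] at this
  grind

theorem idem_mul_idem_mul (x : R) : e * (e * x) = e * x := by
  have := (h.alt e x).1
  rw [associator, h.idem, sub_eq_zero] at this
  exact this.symm

theorem mul_idem_mul_idem (x : R) : x * e * e = x * e := by
  have := (h.alt e x).2
  rwa [associator, h.idem, sub_eq_zero] at this

theorem idem_mul_assoc (x : R) : e * x * e = e * (x * e) := by
  have := h.alt.flexible e x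
  rwa [associator, sub_eq_zero] at this

/-- The products `R₁₁ R₂₁` and `R₁₁ R₂₂` vanish: left multiplication by `e` doubles such a
product. -/
theorem mul_eq_zero_of_left {x y : R} (hx : InPeirce e e x) (hy : e * y = 0) : x * y = 0 := by
  have h1 := h.idem_mul_mul x y
  have h2 := h.idem_mul_idem_mul (x * y)
  rw [hx.left, hx.right, hy, mul_zero, sub_zero] at h1
  rw [h1, mul_add, h1] at h2
  apply h.two
  grind

/-- The product `R₁₂ R₁₁` vanishes: right multiplication by `e` doubles it. -/
theorem mul_eq_zero_of_right {x y : R} (hx : InPeirce e f x) (hy : InPeirce e e y) :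
    x * y = 0 := by
  have h1 := h.mul_mul_idem x y
  have h2 := h.mul_idem_mul_idem (x * y)
  have hx' := h.symm.right_zero hx
  rw [hx', hy.left, hy.right, zero_mul, sub_zero] at h1
  rw [h1, add_mul, h1] at h2
  apply h.two
  grind

theorem diag_mul_diag {x y : R} (hx : InPeirce e e x) (hy : InPeirce e e y) :
    InPeirce e e (x * y) := by
  constructor
  · have h1 := h.idem_mul_mul x y
    rw [hx.left, hx.right, hy.left] at h1
    grind [mul_zero, zero_mul]
  · have h1 := h.mul_mul_idem x y
    rw [hx.right, hy.left, hy.right] at h1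
    grind [mul_zero, zero_mul]

theorem diag_mul_off {x y : R} (hx : InPeirce e e x) (hy : InPeirce e f y) :
    InPeirce e f (x * y) := by
  constructor
  · have h1 := h.idem_mul_mul x y
    rw [hx.left, hx.right, hy.left] at h1
    grind [mul_zero, zero_mul]
  · apply h.symm.right_one
    have h1 := h.mul_mul_idem x y
    rw [hx.right, hy.left, h.symm.right_zero hy] at h1
    grind [mul_zero, zero_mul]

theorem diag_mul_off_rev {x y : R} (hx : InPeirce e e x) (hy : InPeirce f e y) : x * y = 0 :=
  h.mul_eq_zero_of_left hx (h.symm.left_zero hy)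

theorem diag_mul_diag_compl {x y : R} (hx : InPeirce e e x) (hy : InPeirce f f y) : x * y = 0 :=
  h.mul_eq_zero_of_left hx (h.symm.left_zero hy)

theorem off_mul_diag_left {x y : R} (hx : InPeirce e f x) (hy : InPeirce e e y) : x * y = 0 :=
  h.mul_eq_zero_of_right hx hy

/-- Unlike in the associative case, `R₁₂ R₁₂` need not vanish, but it lies in `R₂₁`. -/
theorem off_mul_off {x y : R} (hx : InPeirce e f x) (hy : InPeirce e f y) :
    InPeirce f e (x * y) := by
  have hx' := h.symm.right_zero hx
  have hy' := h.symm.right_zero hy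
  constructor
  · apply h.symm.left_one
    have h1 := h.idem_mul_mul x y
    rw [hx.left, hx', hy.left] at h1
    grind [mul_zero, zero_mul]
  · have h1 := h.mul_mul_idem x y
    rw [hx', hy.left, hy'] at h1
    grind [mul_zero, zero_mul]

theorem off_mul_off_rev {x y : R} (hx : InPeirce e f x) (hy : InPeirce f e y) :
    InPeirce e e (x * y) := by
  have hx' := h.symm.right_zero hx
  have hy' := h.symm.left_zero hy
  constructor
  · have h1 := h.idem_mul_mul x y
    rw [hx.left, hx', hy'] at h1
    grind [mul_zero, zero_mul]
  · have h1 := h.mul_mul_idem x y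
    rw [hx', hy.right, hy'] at h1
    grind [mul_zero, zero_mul]

theorem off_mul_diag {x y : R} (hx : InPeirce e f x) (hy : InPeirce f f y) :
    InPeirce e f (x * y) := by
  have hx' := h.symm.right_zero hx
  have hy' := h.symm.left_zero hy
  constructor
  · have h1 := h.idem_mul_mul x y
    rw [hx.left, hx', hy'] at h1
    grind [mul_zero, zero_mul]
  · apply h.symm.right_one
    have h1 := h.mul_mul_idem x y
    rw [hx', h.symm.right_zero hy, hy'] at h1
    grind [mul_zero, zero_mul]

theorem off_sq {x : R} (hx : InPeirce e f x) : x * x = 0 := by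
  have h1 := (h.alt x e).1
  have h2 := (h.off_mul_off hx hx).right
  rw [associator, h2, h.symm.right_zero hx, mul_zero, sub_zero] at h1
  exact h1

theorem off_mul_comm {x y : R} (hx : InPeirce e f x) (hy : InPeirce e f y) :
    x * y = -(y * x) := by
  have h1 := h.off_sq (hx.add hy)
  have h2 := h.off_sq hx
  have h3 := h.off_sq hy
  simp only [mul_add, add_mul] at h1
  grind

theorem component_diag (x : R) : InPeirce e e (e * x * e) :=
  ⟨by rw [h.idem_mul_assoc, h.idem_mul_idem_mul], h.mul_idem_mul_idem _⟩

theorem idem_mul_assoc_compl (x : R) : e * x * f = e * (x * f) := by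
  rw [h.compl, mul_sub, mul_one, mul_sub, mul_one, mul_sub, h.idem_mul_assoc]

theorem component_off (x : R) : InPeirce e f (e * x * f) :=
  ⟨by rw [h.idem_mul_assoc_compl, h.idem_mul_idem_mul], h.symm.mul_idem_mul_idem _⟩

theorem sum_components (x : R) : e * x * e + e * x * f + f * x * e + f * x * f = x := by
  rw [h.compl]
  simp only [mul_sub, sub_mul, mul_one, one_mul]
  abel

theorem exists_components (x : R) : ∃ a b c d : R, InPeirce e e a ∧ InPeirce e f b ∧
    InPeirce f e c ∧ InPeirce f f d ∧ x = a + b + c + d :=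
  ⟨_, _, _, _, h.component_diag x, h.component_off x, h.symm.component_off x,
    h.symm.component_diag x, (h.sum_components x).symm⟩

theorem eq_zero_of_left {q q' x : R} (h1 : InPeirce e q x) (h2 : InPeirce f q' x) : x = 0 := by
  rw [← h1.left, h.symm.left_zero h2]

/-- Peirce components are unique. -/
theorem components_unique {a b c d x : R} (ha : InPeirce e e a) (hb : InPeirce e f b)
    (hc : InPeirce f e c) (hd : InPeirce f f d) (hx : x = a + b + c + d) :
    e * x * e = a ∧ e * x * f = b ∧ f * x * e = c ∧ f * x * f = d := by
  subst hx
  simp only [mul_add, add_mul, ha.left, hb.left, h.left_zero ha, h.left_zero hb, hc.left, hd.left,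
    h.symm.left_zero hc, h.symm.left_zero hd, ha.right, hb.right, hc.right, hd.right,
    h.right_zero ha, h.symm.right_zero hb, h.right_zero hc, h.symm.right_zero hd, add_zero,
    zero_add, and_self]

end PeircePair

/-! ### Faithful action of the diagonal Peirce components -/

/-- The associator is alternating, so associativity of a product may be checked after permuting the
factors; among Peirce components both sides then often vanish for trivial reasons. -/
theorem IsAlternative.assoc_of_cycle (h : IsAlternative R) {x y z : R}
    (H : y * z * x = y * (z * x)) : x * y * z = x * (y * z) := by
  have := h.cycle x y z
  rwa [associator, associator, H, sub_self, sub_eq_zero] at this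

theorem IsAlternative.assoc_of_swap_left (h : IsAlternative R) {x y z : R}
    (H : y * x * z = y * (x * z)) : x * y * z = x * (y * z) := by
  have := h.swap_left x y z
  rwa [associator, associator, H, sub_self, neg_zero, sub_eq_zero] at this

theorem IsAlternative.assoc_of_swap_right (h : IsAlternative R) {x y z : R}
    (H : x * z * y = x * (z * y)) : x * y * z = x * (y * z) := by
  have := h.swap_right x y z
  rwa [associator, associator, H, sub_self, neg_zero, sub_eq_zero] at this

theorem IsAlternative.assoc_of_swap_outer (h : IsAlternative R) {x y z : R}
    (H : z * y * x = z * (y * x)) : x * y * z = x * (y * z) := by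
  have := h.swap_outer x y z
  rwa [associator, associator, H, sub_self, neg_zero, sub_eq_zero] at this

/-- Primeness for ideals given by predicates. -/
theorem IsPrime.eq_zero_or {P Q : R → Prop} (hp : IsPrime R)
    (hP0 : P 0) (hPadd : ∀ x y, P x → P y → P (x + y)) (hPneg : ∀ x, P x → P (-x))
    (hPl : ∀ r x, P x → P (r * x)) (hPr : ∀ x r, P x → P (x * r))
    (hQ0 : Q 0) (hQadd : ∀ x y, Q x → Q y → Q (x + y)) (hQneg : ∀ x, Q x → Q (-x))
    (hQl : ∀ r x, Q x → Q (r * x)) (hQr : ∀ x r, Q x → Q (x * r))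
    (hPQ : ∀ x y, P x → Q y → x * y = 0) : (∀ x, P x → x = 0) ∨ (∀ y, Q y → y = 0) := by
  let I : TwoSidedIdeal R := .mk' {x | P x} hP0 (hPadd _ _) (hPneg _) (hPl _ _) (hPr _ _)
  let J : TwoSidedIdeal R := .mk' {x | Q x} hQ0 (hQadd _ _) (hQneg _) (hQl _ _) (hQr _ _)
  have mI (x : R) : x ∈ I ↔ P x := TwoSidedIdeal.mem_mk' ..
  have mJ (x : R) : x ∈ J ↔ Q x := TwoSidedIdeal.mem_mk' ..
  by_cases hI : I = ⊥
  · left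
    intro x hx
    rwa [← mI, hI, TwoSidedIdeal.mem_bot] at hx
  by_cases hJ : J = ⊥
  · right
    intro x hx
    rwa [← mJ, hJ, TwoSidedIdeal.mem_bot] at hx
  obtain ⟨a, ha, b, hb, hab⟩ := hp I J hI hJ
  exact absurd (hPQ a b ((mI a).1 ha) ((mJ b).1 hb)) hab

section Annihilators

variable {e f : R}

/-- Elements of `e R e` annihilating `e R f`. -/
structure AnnDiag (e f a : R) : Prop where
  mem : InPeirce e e a
  ann : ∀ c, InPeirce e f c → a * c = 0

/-- Elements of `f R e` annihilating both off-diagonal components from the left, and which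
`e R f` carries into `AnnDiag e f`. -/
structure AnnOff (e f w : R) : Prop where
  mem : InPeirce f e w
  ann : ∀ c, InPeirce e f c → w * c = 0
  ann_rev : ∀ s, InPeirce f e s → w * s = 0
  mul : ∀ c, InPeirce e f c → AnnDiag e f (c * w)

theorem AnnDiag.add {a b : R} (ha : AnnDiag e f a) (hb : AnnDiag e f b) :
    AnnDiag e f (a + b) :=
  ⟨ha.mem.add hb.mem, fun c hc => by rw [add_mul, ha.ann c hc, hb.ann c hc, add_zero]⟩

theorem AnnDiag.neg {a : R} (ha : AnnDiag e f a) : AnnDiag e f (-a) :=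
  ⟨ha.mem.neg, fun c hc => by rw [neg_mul, ha.ann c hc, neg_zero]⟩

theorem AnnDiag.zero : AnnDiag e f 0 := ⟨.zero, fun c _ => zero_mul c⟩

theorem AnnOff.add {a b : R} (ha : AnnOff e f a) (hb : AnnOff e f b) : AnnOff e f (a + b) where
  mem := ha.mem.add hb.mem
  ann c hc := by rw [add_mul, ha.ann c hc, hb.ann c hc, add_zero]
  ann_rev c hc := by rw [add_mul, ha.ann_rev c hc, hb.ann_rev c hc, add_zero]
  mul c hc := by rw [mul_add]; exact (ha.mul c hc).add (hb.mul c hc)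

theorem AnnOff.neg {a : R} (ha : AnnOff e f a) : AnnOff e f (-a) where
  mem := ha.mem.neg
  ann c hc := by rw [neg_mul, ha.ann c hc, neg_zero]
  ann_rev c hc := by rw [neg_mul, ha.ann_rev c hc, neg_zero]
  mul c hc := by rw [mul_neg]; exact (ha.mul c hc).neg

theorem AnnOff.zero : AnnOff e f 0 where
  mem := .zero
  ann c _ := zero_mul c
  ann_rev c _ := zero_mul c
  mul c _ := by rw [mul_zero]; exact .zero

/-- The additive subgroup generated by the products `e R f * f R e`. -/
def offProducts (e f : R) : AddSubgroup R :=
  .closure {x | ∃ b c, InPeirce e f b ∧ InPeirce f e c ∧ x = b * c}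

theorem mul_mem_offProducts {b c : R} (hb : InPeirce e f b) (hc : InPeirce f e c) :
    b * c ∈ offProducts e f :=
  AddSubgroup.subset_closure ⟨b, c, hb, hc, rfl⟩

/-- The sum of `AnnDiag e f` and `AnnOff e f`; it is a two-sided ideal annihilating `OffIdeal e f`
from the left. -/
def AnnIdeal (e f x : R) : Prop := ∃ a w, AnnDiag e f a ∧ AnnOff e f w ∧ x = a + w

/-- The ideal generated by the off-diagonal components, described by components. -/
def OffIdeal (e f x : R) : Prop := ∃ u b c v, u ∈ offProducts e f ∧ InPeirce e f b ∧
  InPeirce f e c ∧ v ∈ offProducts f e ∧ x = u + b + c + v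

end Annihilators

namespace PeircePair

variable {e f : R} (h : PeircePair e f)
include h

/-- The Peirce multiplication table: the components of a product. -/
theorem mul_sum {a b c d a' b' c' d' : R} (ha : InPeirce e e a) (hb : InPeirce e f b)
    (hc : InPeirce f e c) (hd : InPeirce f f d) (ha' : InPeirce e e a') (hb' : InPeirce e f b')
    (hc' : InPeirce f e c') (hd' : InPeirce f f d') :
    (a + b + c + d) * (a' + b' + c' + d') =
      (a * a' + b * c') + (a * b' + b * d' + c * c') + (c * a' + d * c' + b * b') +
        (c * b' + d * d') := by
  simp only [mul_add, add_mul]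
  rw [h.diag_mul_off_rev ha hc', h.diag_mul_diag_compl ha hd', h.off_mul_diag_left hb ha',
    h.symm.diag_mul_off_rev hd hb', h.symm.diag_mul_diag_compl hd ha',
    h.symm.off_mul_diag_left hc hd']
  abel

theorem diag_assoc_off {x y z : R} (hx : InPeirce e e x) (hy : InPeirce e e y)
    (hz : InPeirce e f z) : x * y * z = x * (y * z) := by
  apply h.alt.assoc_of_cycle
  rw [h.off_mul_diag_left (h.diag_mul_off hy hz) hx, h.off_mul_diag_left hz hx, mul_zero]

theorem diag_off_off_assoc {x y z : R} (hx : InPeirce e e x) (hy : InPeirce e f y)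
    (hz : InPeirce f e z) : x * y * z = x * (y * z) := by
  apply h.alt.assoc_of_swap_left
  rw [h.off_mul_diag_left hy hx, h.diag_mul_off_rev hx hz, mul_zero, zero_mul]

theorem off_off_diag_assoc {x y z : R} (hx : InPeirce e f x) (hy : InPeirce f e y)
    (hz : InPeirce e e z) : x * y * z = x * (y * z) := by
  apply h.alt.assoc_of_swap_right
  rw [h.off_mul_diag_left hx hz, h.diag_mul_off_rev hz hy, mul_zero, zero_mul]

theorem off_diag_off_assoc {x y z : R} (hx : InPeirce f e x) (hy : InPeirce e e y)
    (hz : InPeirce e f z) : x * y * z = x * (y * z) := by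
  apply h.alt.assoc_of_swap_outer
  rw [h.off_mul_diag_left hz hy, h.diag_mul_off_rev hy hx, mul_zero, zero_mul]

theorem annDiag_left {r a : R} (hr : InPeirce e e r) (ha : AnnDiag e f a) :
    AnnDiag e f (r * a) :=
  ⟨h.diag_mul_diag hr ha.mem, fun c hc => by
    rw [h.diag_assoc_off hr ha.mem hc, ha.ann c hc, mul_zero]⟩

theorem annDiag_right {r a : R} (hr : InPeirce e e r) (ha : AnnDiag e f a) :
    AnnDiag e f (a * r) :=
  ⟨h.diag_mul_diag ha.mem hr, fun c hc => by
    rw [h.diag_assoc_off ha.mem hr hc, ha.ann _ (h.diag_mul_off hr hc)]⟩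

theorem annOff_of_annDiag {r a : R} (hr : InPeirce f e r) (ha : AnnDiag e f a) :
    AnnOff e f (r * a) where
  mem := h.symm.off_mul_diag hr ha.mem
  ann c hc := by rw [h.off_diag_off_assoc hr ha.mem hc, ha.ann c hc, mul_zero]
  ann_rev s hs := by
    have has := h.diag_mul_off_rev ha.mem hs
    rw [h.alt.assoc_of_cycle, has, mul_zero]
    rw [has, zero_mul, ha.ann _ (h.symm.off_mul_off hs hr)]
  mul c hc := by
    rw [← h.off_off_diag_assoc hc hr ha.mem]
    exact h.annDiag_left (h.off_mul_off_rev hc hr) ha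

theorem annOff_left {r w : R} (hr : InPeirce f f r) (hw : AnnOff e f w) :
    AnnOff e f (r * w) where
  mem := h.symm.diag_mul_off hr hw.mem
  ann c hc := by
    rw [h.alt.assoc_of_cycle, hw.ann c hc, mul_zero]
    rw [hw.ann c hc, hw.ann _ (h.off_mul_diag hc hr), zero_mul]
  ann_rev s hs := by
    rw [h.alt.assoc_of_swap_left, hw.ann_rev s hs, mul_zero]
    rw [h.symm.off_mul_diag_left hw.mem hr, zero_mul, hw.ann_rev _ (h.symm.diag_mul_off hr hs)]
  mul c hc := by
    rw [← h.alt.assoc_of_cycle]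
    · exact hw.mul _ (h.off_mul_diag hc hr)
    · apply h.alt.assoc_of_cycle
      rw [hw.ann c hc, hw.ann _ (h.off_mul_diag hc hr), zero_mul]

theorem annOff_right {r w : R} (hr : InPeirce e e r) (hw : AnnOff e f w) :
    AnnOff e f (w * r) where
  mem := h.symm.off_mul_diag hw.mem hr
  ann c hc := by
    rw [h.off_diag_off_assoc hw.mem hr hc, hw.ann _ (h.diag_mul_off hr hc)]
  ann_rev s hs := by
    have hrs := h.diag_mul_off_rev hr hs
    rw [h.alt.assoc_of_cycle, hrs, mul_zero]
    rw [hrs, zero_mul, h.symm.off_mul_comm hs hw.mem, hw.ann_rev s hs, neg_zero, mul_zero]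
  mul c hc := by
    rw [← h.off_off_diag_assoc hc hw.mem hr]
    exact h.annDiag_right hr (hw.mul c hc)

theorem inPeirce_of_mem_offProducts {u : R} (hu : u ∈ offProducts e f) : InPeirce e e u := by
  induction hu using AddSubgroup.closure_induction with
  | mem x hx =>
    obtain ⟨b, c, hb, hc, rfl⟩ := hx
    exact h.off_mul_off_rev hb hc
  | zero => exact .zero
  | add x y _ _ hx hy => exact hx.add hy
  | neg x _ hx => exact hx.neg

theorem diag_mul_mem_offProducts {r u : R} (hr : InPeirce e e r) (hu : u ∈ offProducts e f) :
    r * u ∈ offProducts e f := by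
  induction hu using AddSubgroup.closure_induction with
  | mem x hx =>
    obtain ⟨b, c, hb, hc, rfl⟩ := hx
    rw [← h.diag_off_off_assoc hr hb hc]
    exact mul_mem_offProducts (h.diag_mul_off hr hb) hc
  | zero => rw [mul_zero]; exact zero_mem _
  | add x y _ _ hx hy => rw [mul_add]; exact add_mem hx hy
  | neg x _ hx => rw [mul_neg]; exact neg_mem hx

theorem mul_diag_mem_offProducts {r u : R} (hr : InPeirce e e r) (hu : u ∈ offProducts e f) :
    u * r ∈ offProducts e f := by
  induction hu using AddSubgroup.closure_induction with
  | mem x hx =>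
    obtain ⟨b, c, hb, hc, rfl⟩ := hx
    rw [h.off_off_diag_assoc hb hc hr]
    exact mul_mem_offProducts hb (h.symm.off_mul_diag hc hr)
  | zero => rw [zero_mul]; exact zero_mem _
  | add x y _ _ hx hy => rw [add_mul]; exact add_mem hx hy
  | neg x _ hx => rw [neg_mul]; exact neg_mem hx

theorem annDiag_mul_offProducts {a u : R} (ha : AnnDiag e f a) (hu : u ∈ offProducts e f) :
    a * u = 0 := by
  induction hu using AddSubgroup.closure_induction with
  | mem x hx =>
    obtain ⟨b, c, hb, hc, rfl⟩ := hx
    rw [← h.diag_off_off_assoc ha.mem hb hc, ha.ann b hb, zero_mul]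
  | zero => rw [mul_zero]
  | add x y _ _ hx hy => rw [mul_add, hx, hy, add_zero]
  | neg x _ hx => rw [mul_neg, hx, neg_zero]

theorem annOff_mul_offProducts {w u : R} (hw : AnnOff e f w) (hu : u ∈ offProducts e f) :
    w * u = 0 := by
  induction hu using AddSubgroup.closure_induction with
  | mem x hx =>
    obtain ⟨b, c, hb, hc, rfl⟩ := hx
    rw [← h.alt.assoc_of_swap_right, hw.ann b hb, zero_mul]
    rw [hw.ann_rev c hc, h.symm.off_mul_diag_left hw.mem (h.symm.off_mul_off_rev hc hb), zero_mul]
  | zero => rw [mul_zero]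
  | add x y _ _ hx hy => rw [mul_add, hx, hy, add_zero]
  | neg x _ hx => rw [mul_neg, hx, neg_zero]

theorem annIdeal_left (r x : R) (hx : AnnIdeal e f x) : AnnIdeal e f (r * x) := by
  obtain ⟨a, w, ha, hw, rfl⟩ := hx
  obtain ⟨r₁, r₂, r₃, r₄, h₁, h₂, h₃, h₄, rfl⟩ := h.exists_components r
  refine ⟨r₁ * a + r₂ * w, r₃ * a + r₄ * w, (h.annDiag_left h₁ ha).add (hw.mul _ h₂),
    (h.annOff_of_annDiag h₃ ha).add (h.annOff_left h₄ hw), ?_⟩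
  have := h.mul_sum h₁ h₂ h₃ h₄ ha.mem .zero hw.mem .zero
  rw [h.symm.off_mul_comm h₃ hw.mem, hw.ann_rev _ h₃] at this
  simpa using this

theorem annIdeal_right (x r : R) (hx : AnnIdeal e f x) : AnnIdeal e f (x * r) := by
  obtain ⟨a, w, ha, hw, rfl⟩ := hx
  obtain ⟨r₁, r₂, r₃, r₄, h₁, h₂, h₃, h₄, rfl⟩ := h.exists_components r
  refine ⟨a * r₁, w * r₁, h.annDiag_right h₁ ha, h.annOff_right h₁ hw, ?_⟩
  have := h.mul_sum ha.mem .zero hw.mem .zero h₁ h₂ h₃ h₄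
  rw [hw.ann_rev _ h₃, hw.ann _ h₂, ha.ann _ h₂] at this
  simpa using this

theorem offIdeal_left (r x : R) (hx : OffIdeal e f x) : OffIdeal e f (r * x) := by
  obtain ⟨u, b, c, v, hu, hb, hc, hv, rfl⟩ := hx
  obtain ⟨r₁, r₂, r₃, r₄, h₁, h₂, h₃, h₄, rfl⟩ := h.exists_components r
  have hu' := h.inPeirce_of_mem_offProducts hu
  have hv' := h.symm.inPeirce_of_mem_offProducts hv
  exact ⟨_, _, _, _, add_mem (h.diag_mul_mem_offProducts h₁ hu) (mul_mem_offProducts h₂ hc),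
    ((h.diag_mul_off h₁ hb).add (h.off_mul_diag h₂ hv')).add (h.symm.off_mul_off h₃ hc),
    ((h.symm.off_mul_diag h₃ hu').add (h.symm.diag_mul_off h₄ hc)).add (h.off_mul_off h₂ hb),
    add_mem (mul_mem_offProducts h₃ hb) (h.symm.diag_mul_mem_offProducts h₄ hv),
    h.mul_sum h₁ h₂ h₃ h₄ hu' hb hc hv'⟩

theorem offIdeal_right (x r : R) (hx : OffIdeal e f x) : OffIdeal e f (x * r) := by
  obtain ⟨u, b, c, v, hu, hb, hc, hv, rfl⟩ := hx
  obtain ⟨r₁, r₂, r₃, r₄, h₁, h₂, h₃, h₄, rfl⟩ := h.exists_components r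
  have hu' := h.inPeirce_of_mem_offProducts hu
  have hv' := h.symm.inPeirce_of_mem_offProducts hv
  exact ⟨_, _, _, _, add_mem (h.mul_diag_mem_offProducts h₁ hu) (mul_mem_offProducts hb h₃),
    ((h.diag_mul_off hu' h₂).add (h.off_mul_diag hb h₄)).add (h.symm.off_mul_off hc h₃),
    ((h.symm.off_mul_diag hc h₁).add (h.symm.diag_mul_off hv' h₃)).add (h.off_mul_off hb h₂),
    add_mem (mul_mem_offProducts hc h₂) (h.symm.mul_diag_mem_offProducts h₄ hv),
    h.mul_sum hu' hb hc hv' h₁ h₂ h₃ h₄⟩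

theorem annIdeal_mul_offIdeal (x y : R) (hx : AnnIdeal e f x) (hy : OffIdeal e f y) :
    x * y = 0 := by
  obtain ⟨u, b, c, v, hu, hb, hc, hv, rfl⟩ := hy
  obtain ⟨a, w, ha, hw, rfl⟩ := hx
  have hu' := h.inPeirce_of_mem_offProducts hu
  have hv' := h.symm.inPeirce_of_mem_offProducts hv
  have := h.mul_sum ha.mem .zero hw.mem .zero hu' hb hc hv'
  rw [hw.ann_rev _ hc, hw.ann _ hb, ha.ann _ hb, h.annDiag_mul_offProducts ha hu,
    h.annOff_mul_offProducts hw hu] at this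
  simpa using this

/-- A prime ring with a nontrivial idempotent has nonzero off-diagonal Peirce components. -/
theorem false_of_off_eq_zero (hp : IsPrime R) (he : e ≠ 0) (hf : f ≠ 0)
    (H₁ : ∀ c, InPeirce e f c → c = 0) (H₂ : ∀ c, InPeirce f e c → c = 0) : False := by
  have decomp (r : R) : ∃ a d, InPeirce e e a ∧ InPeirce f f d ∧ r = a + d := by
    obtain ⟨a, b, c, d, ha, hb, hc, hd, rfl⟩ := h.exists_components r
    exact ⟨a, d, ha, hd, by rw [H₁ b hb, H₂ c hc, add_zero, add_zero]⟩
  have left {e f : R} (h : PeircePair e f) {a d x : R} (ha : InPeirce e e a)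
      (hd : InPeirce f f d) (hx : InPeirce e e x) : InPeirce e e ((a + d) * x) := by
    rw [add_mul, h.symm.diag_mul_diag_compl hd hx, add_zero]
    exact h.diag_mul_diag ha hx
  have right {e f : R} (h : PeircePair e f) {a d x : R} (ha : InPeirce e e a)
      (hd : InPeirce f f d) (hx : InPeirce e e x) : InPeirce e e (x * (a + d)) := by
    rw [mul_add, h.diag_mul_diag_compl hx hd, add_zero]
    exact h.diag_mul_diag hx ha
  have := hp.eq_zero_or (P := InPeirce e e) (Q := InPeirce f f) .zero (fun _ _ => .add)
    (fun _ => .neg)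
    (fun r x hx => by
      obtain ⟨a, d, ha, hd, rfl⟩ := decomp r
      exact left h ha hd hx)
    (fun x r hx => by
      obtain ⟨a, d, ha, hd, rfl⟩ := decomp r
      exact right h ha hd hx) .zero (fun _ _ => .add) (fun _ => .neg)
    (fun r x hx => by
      obtain ⟨a, d, ha, hd, rfl⟩ := decomp r
      rw [add_comm]
      exact left h.symm hd ha hx)
    (fun x r hx => by
      obtain ⟨a, d, ha, hd, rfl⟩ := decomp r
      rw [add_comm]
      exact right h.symm hd ha hx) (fun x y => h.diag_mul_diag_compl)
  rcases this with H | H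
  · exact he (H e ⟨h.idem, h.idem⟩)
  · exact hf (H f ⟨h.symm.idem, h.symm.idem⟩)

/-- In a prime alternative ring, `e R e` acts faithfully on `e R f`. -/
theorem diag_eq_zero (hp : IsPrime R) (he : e ≠ 0) (hf : f ≠ 0) {u : R} (hu : InPeirce e e u)
    (H : ∀ c, InPeirce e f c → u * c = 0) : u = 0 := by
  have := hp.eq_zero_or (P := AnnIdeal e f) (Q := OffIdeal e f)
    ⟨0, 0, .zero, .zero, (add_zero 0).symm⟩
    (by
      rintro _ _ ⟨a, w, ha, hw, rfl⟩ ⟨a', w', ha', hw', rfl⟩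
      exact ⟨a + a', w + w', ha.add ha', hw.add hw', by abel⟩)
    (by
      rintro _ ⟨a, w, ha, hw, rfl⟩
      exact ⟨-a, -w, ha.neg, hw.neg, by abel⟩)
    h.annIdeal_left h.annIdeal_right
    ⟨0, 0, 0, 0, zero_mem _, .zero, .zero, zero_mem _, by simp⟩
    (by
      rintro _ _ ⟨u, b, c, v, hu, hb, hc, hv, rfl⟩ ⟨u', b', c', v', hu', hb', hc', hv', rfl⟩
      exact ⟨u + u', b + b', c + c', v + v', add_mem hu hu', hb.add hb', hc.add hc',
        add_mem hv hv', by abel⟩)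
    (by
      rintro _ ⟨u, b, c, v, hu, hb, hc, hv, rfl⟩
      exact ⟨-u, -b, -c, -v, neg_mem hu, hb.neg, hc.neg, neg_mem hv, by abel⟩)
    h.offIdeal_left h.offIdeal_right h.annIdeal_mul_offIdeal
  rcases this with K | K
  · exact K u ⟨u, 0, ⟨hu, H⟩, .zero, (add_zero u).symm⟩
  · refine (h.false_of_off_eq_zero hp he hf (fun c hc => ?_) (fun c hc => ?_)).elim
    · exact K c ⟨0, c, 0, 0, zero_mem _, hc, .zero, zero_mem _, by simp⟩
    · exact K c ⟨0, 0, c, 0, zero_mem _, .zero, hc, zero_mem _, by simp⟩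

end PeircePair

/-! ### Commutators and the center -/

theorem lie_add_right (x y z : R) : ⁅x, y + z⁆ = ⁅x, y⁆ + ⁅x, z⁆ := by
  simp only [Ring.lie_def, mul_add, add_mul]; abel

theorem lie_add_left (x y z : R) : ⁅x + y, z⁆ = ⁅x, z⁆ + ⁅y, z⁆ := by
  simp only [Ring.lie_def, mul_add, add_mul]; abel

theorem lie_sub_right (x y z : R) : ⁅x, y - z⁆ = ⁅x, y⁆ - ⁅x, z⁆ := by
  simp only [Ring.lie_def, mul_sub, sub_mul]; abel

theorem lie_sub_left (x y z : R) : ⁅x - y, z⁆ = ⁅x, z⁆ - ⁅y, z⁆ := by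
  simp only [Ring.lie_def, mul_sub, sub_mul]; abel

theorem lie_neg_right (x y : R) : ⁅x, -y⁆ = -⁅x, y⁆ := by
  simp only [Ring.lie_def, mul_neg, neg_mul]; abel

theorem lie_neg_left (x y : R) : ⁅-x, y⁆ = -⁅x, y⁆ := by
  simp only [Ring.lie_def, mul_neg, neg_mul]; abel

theorem lie_antisymm (x y : R) : ⁅x, y⁆ = -⁅y, x⁆ := by
  simp only [Ring.lie_def]; abel

theorem lie_zero_right (x : R) : ⁅x, (0 : R)⁆ = 0 := by simp [Ring.lie_def]

theorem lie_zero_left (x : R) : ⁅(0 : R), x⁆ = 0 := by simp [Ring.lie_def]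

theorem lie_self_eq (x : R) : ⁅x, x⁆ = 0 := sub_self _

theorem lie_of_mem_center {z : R} (hz : z ∈ center R) (x : R) : ⁅z, x⁆ = 0 :=
  ((mem_center_iff z).1 hz).2 x

theorem lie_of_mem_center' {z : R} (hz : z ∈ center R) (x : R) : ⁅x, z⁆ = 0 := by
  rw [lie_antisymm, lie_of_mem_center hz, neg_zero]

theorem add_mem_center {x y : R} (hx : x ∈ center R) (hy : y ∈ center R) : x + y ∈ center R :=
  Set.add_mem_center hx hy

theorem neg_mem_center {x : R} (hx : x ∈ center R) : -x ∈ center R :=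
  Set.neg_mem_center hx

theorem sub_mem_center {x y : R} (hx : x ∈ center R) (hy : y ∈ center R) : x - y ∈ center R := by
  rw [sub_eq_add_neg]; exact add_mem_center hx (neg_mem_center hy)

/-- Complementary nonzero idempotents `e + f = 1` in a prime alternative ring without `2`- and
`3`-torsion in which every nonzero central element divides everything. -/
structure PrimePeirce (e f : R) : Prop extends PeircePair e f where
  three : TorsionFreeBy 3 R
  prime : IsPrime R
  div : ∀ z ∈ center R, z ≠ 0 → ∀ y : R, ∃ x : R, z * x = y
  left_ne : e ≠ 0
  right_ne : f ≠ 0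

theorem InPeirce.lie_eq_zero {e x : R} (hx : InPeirce e e x) : ⁅x, e⁆ = 0 := by
  rw [Ring.lie_def, hx.left, hx.right, sub_self]

namespace PeircePair

variable {e f : R} (h : PeircePair e f)
include h

theorem lie_compl (x : R) : ⁅x, f⁆ = -⁅x, e⁆ := by
  rw [h.compl, lie_sub_right]
  simp [Ring.lie_def]

theorem compl_lie (x : R) : ⁅f, x⁆ = ⁅x, e⁆ := by
  rw [lie_antisymm, h.lie_compl, neg_neg]

theorem lie_off {x : R} (hx : InPeirce e f x) : ⁅e, x⁆ = x := by
  rw [Ring.lie_def, hx.left, h.symm.right_zero hx, sub_zero]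

theorem off_lie {x : R} (hx : InPeirce e f x) : ⁅x, e⁆ = -x := by
  rw [lie_antisymm, h.lie_off hx]

theorem off_rev_lie {x : R} (hx : InPeirce f e x) : ⁅x, e⁆ = x := by
  rw [← h.compl_lie, h.symm.lie_off hx]

theorem lie_off_rev {x : R} (hx : InPeirce f e x) : ⁅e, x⁆ = -x := by
  rw [lie_antisymm, h.off_rev_lie hx]

theorem diag_compl_lie {x : R} (hx : InPeirce f f x) : ⁅x, e⁆ = 0 := by
  rw [Ring.lie_def, h.symm.right_zero hx, h.symm.left_zero hx, sub_self]

theorem off_of_lie {x : R} (hx : ⁅e, x⁆ = x) : InPeirce e f x := by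
  obtain ⟨a, b, c, d, ha, hb, hc, hd, rfl⟩ := h.exists_components x
  simp only [lie_add_right] at hx
  rw [lie_antisymm, ha.lie_eq_zero, h.lie_off hb, h.lie_off_rev hc, lie_antisymm,
    h.diag_compl_lie hd] at hx
  have u := h.components_unique ha hb hc hd rfl
  have v := h.components_unique .zero hb hc.neg .zero
    (show a + b + c + d = 0 + b + -c + 0 by rw [← hx]; abel)
  have ha0 : a = 0 := u.1.symm.trans v.1
  have hd0 : d = 0 := u.2.2.2.symm.trans v.2.2.2
  have hc0 : c = 0 := by
    apply h.two
    have := u.2.2.1.symm.trans v.2.2.1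
    grind
  rw [ha0, hd0, hc0]
  simpa using hb

/-- The diagonal part `e R e + f R f` is the centralizer of `e`. -/
theorem exists_diag_of_lie {x : R} (hx : ⁅x, e⁆ = 0) :
    ∃ a d, InPeirce e e a ∧ InPeirce f f d ∧ x = a + d := by
  obtain ⟨a, b, c, d, ha, hb, hc, hd, rfl⟩ := h.exists_components x
  simp only [lie_add_left] at hx
  rw [ha.lie_eq_zero, h.off_lie hb, h.off_rev_lie hc, h.diag_compl_lie hd] at hx
  have v := h.components_unique .zero hb.neg hc .zero hx.symm
  simp only [mul_zero, zero_mul] at v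
  have hb0 : b = 0 := by simpa using v.2.1.symm
  refine ⟨a, d, ha, hd, ?_⟩
  rw [hb0, ← v.2.2.1]
  abel

theorem diag_lie_off {x y : R} (hx : ⁅x, e⁆ = 0) (hy : InPeirce e f y) : InPeirce e f ⁅x, y⁆ := by
  obtain ⟨a, d, ha, hd, rfl⟩ := h.exists_diag_of_lie hx
  rw [lie_add_left, Ring.lie_def, Ring.lie_def, h.off_mul_diag_left hy ha,
    h.symm.diag_mul_off_rev hd hy, sub_zero, zero_sub]
  exact (h.diag_mul_off ha hy).add (h.off_mul_diag hy hd).neg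

theorem lie_compl_eq_zero {x : R} (hx : ⁅x, e⁆ = 0) : ⁅x, f⁆ = 0 := by
  rw [h.lie_compl, hx, neg_zero]

theorem diag_lie_off_rev {x y : R} (hx : ⁅x, e⁆ = 0) (hy : InPeirce f e y) :
    InPeirce f e ⁅x, y⁆ :=
  h.symm.diag_lie_off (h.lie_compl_eq_zero hx) hy

theorem off_lie_off {x y : R} (hx : InPeirce e f x) (hy : InPeirce e f y) :
    InPeirce f e ⁅x, y⁆ := by
  rw [Ring.lie_def, sub_eq_add_neg]
  exact (h.off_mul_off hx hy).add (h.off_mul_off hy hx).neg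

theorem off_lie_off_rev {x y : R} (hx : InPeirce e f x) (hy : InPeirce f e y) :
    ⁅⁅x, y⁆, e⁆ = 0 := by
  rw [Ring.lie_def x y, lie_sub_left, (h.off_mul_off_rev hx hy).lie_eq_zero,
    h.diag_compl_lie (h.symm.off_mul_off_rev hy hx), sub_zero]

/-- The `e R f` component of `[a, x]`, for `x` in `e R f`, involves only the diagonal part
of `a`. -/
theorem lie_off_component {a₁ a₂ a₃ a₄ x : R} (h₁ : InPeirce e e a₁) (h₂ : InPeirce e f a₂)
    (h₃ : InPeirce f e a₃) (h₄ : InPeirce f f a₄) (hx : InPeirce e f x) :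
    e * ⁅a₁ + a₂ + a₃ + a₄, x⁆ * f = ⁅a₁ + a₄, x⁆ := by
  have l := h.mul_sum h₁ h₂ h₃ h₄ .zero hx .zero .zero
  have r := h.mul_sum .zero hx .zero .zero h₁ h₂ h₃ h₄
  simp only [mul_zero, zero_mul, add_zero, zero_add] at l r
  have hd := h.symm.diag_mul_off_rev h₄ hx
  have hd' := h.off_mul_diag_left hx h₁
  have hdl : ⁅a₁ + a₄, x⁆ = a₁ * x - x * a₄ := by
    rw [Ring.lie_def, mul_add, add_mul, hd, hd', add_zero, zero_add]
  rw [hdl, Ring.lie_def, l, r]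
  exact (h.components_unique (h.off_mul_off_rev hx h₃).neg
    ((h.diag_mul_off h₁ hx).add (h.off_mul_diag hx h₄).neg)
    ((h.off_mul_off h₂ hx).add (h.off_mul_off hx h₂).neg) (h.symm.off_mul_off_rev h₃ hx)
    (by abel)).2.1.trans (sub_eq_add_neg _ _).symm

end PeircePair

namespace PrimePeirce

variable {e f : R} (h : PrimePeirce e f)
include h

theorem symm : PrimePeirce f e where
  toPeircePair := h.toPeircePair.symm
  three := h.three
  prime := h.prime
  div := h.div
  left_ne := h.right_ne
  right_ne := h.left_ne

/-- The relation `a c = c d` for all `c` in `e R f` makes `⁅a, b⁆` annihilate `e R f`. -/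
theorem lie_diag_eq_zero {a b d : R} (ha : InPeirce e e a) (hd : InPeirce f f d)
    (hb : InPeirce e e b) (H : ∀ c, InPeirce e f c → ⁅a + d, c⁆ = 0) : ⁅a, b⁆ = 0 := by
  have key (c : R) (hc : InPeirce e f c) : a * c = c * d := by
    have := H c hc
    rwa [Ring.lie_def, mul_add, add_mul, h.off_mul_diag_left hc ha,
      h.toPeircePair.symm.diag_mul_off_rev hd hc, add_zero, zero_add, sub_eq_zero] at this
  refine h.diag_eq_zero h.prime h.left_ne h.right_ne ?_ fun c hc => ?_
  · rw [Ring.lie_def, sub_eq_add_neg]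
    exact (h.diag_mul_diag ha hb).add (h.diag_mul_diag hb ha).neg
  · rw [Ring.lie_def, sub_mul, h.diag_assoc_off ha hb hc, h.diag_assoc_off hb ha hc,
      key _ (h.diag_mul_off hb hc), key c hc, sub_eq_zero]
    apply h.alt.assoc_of_swap_right
    rw [h.diag_mul_diag_compl hb hd, h.toPeircePair.symm.diag_mul_off_rev hd hc, mul_zero,
      zero_mul]

/-- A diagonal element commuting with both off-diagonal components is central. -/
theorem mem_center_of_diag {x : R} (hx : ⁅x, e⁆ = 0) (H₁ : ∀ c, InPeirce e f c → ⁅x, c⁆ = 0)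
    (H₂ : ∀ c, InPeirce f e c → ⁅x, c⁆ = 0) : x ∈ center R := by
  apply h.alt.mem_center_of_commute h.three
  intro y
  obtain ⟨a, d, ha, hd, rfl⟩ := h.exists_diag_of_lie hx
  obtain ⟨y₁, y₂, y₃, y₄, h₁, h₂, h₃, h₄, rfl⟩ := h.exists_components y
  have e1 : ⁅a + d, y₁⁆ = 0 := by
    rw [lie_add_left, h.lie_diag_eq_zero ha hd h₁ H₁, Ring.lie_def,
      h.toPeircePair.symm.diag_mul_diag_compl hd h₁, h.diag_mul_diag_compl h₁ hd]
    simp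
  have e4 : ⁅a + d, y₄⁆ = 0 := by
    rw [lie_add_left, h.symm.lie_diag_eq_zero hd ha h₄ (by rwa [add_comm]), Ring.lie_def,
      h.toPeircePair.symm.diag_mul_diag_compl h₄ ha, h.diag_mul_diag_compl ha h₄]
    simp
  rw [lie_add_right, lie_add_right, lie_add_right, e1, e4, H₁ _ h₂, H₂ _ h₃]
  simp

theorem eq_zero_of_central_diag {z : R} (hz : z ∈ center R) (hz' : InPeirce e e z) : z = 0 := by
  by_contra hne
  obtain ⟨w, hw⟩ := h.div z hz hne f
  have hc : IsMulCentral z := hz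
  apply h.right_ne
  calc f = f * (z * w) := by rw [hw, h.toPeircePair.symm.idem]
    _ = f * z * w := (hc.mid_assoc f w).symm
    _ = 0 := by rw [h.left_zero hz', zero_mul]

theorem eq_zero_of_central_mul {z x : R} (hz : z ∈ center R) (hne : z ≠ 0) (hx : z * x = 0) :
    x = 0 := by
  obtain ⟨w, hw⟩ := h.div z hz hne 1
  have hc : IsMulCentral z := hz
  rw [← one_mul x, ← hw, (hc.comm w).eq, hc.mid_assoc, hx, mul_zero]

end PrimePeirce

/-! ### Additivity of a Lie multiplicative derivation modulo the center -/

/-- The deviation of `D` from additivity on three summands. -/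
def deviation (D : R → R) (x y w : R) : R := D (x + y + w) - D x - D y - D w

theorem deviation_rotate (D : R → R) (x y w : R) : deviation D x y w = deviation D y w x := by
  rw [deviation, deviation, show x + y + w = y + w + x by abel]
  abel

theorem deviation_swap (D : R → R) (x y w : R) : deviation D x y w = deviation D y x w := by
  rw [deviation, deviation, add_comm x y]
  abel

namespace IsLieMulDerivation

variable {D : R → R} (hD : IsLieMulDerivation D)
include hD

theorem map_zero : D 0 = 0 := by
  have := hD 0 0
  simpa [Ring.lie_def] using this

theorem deviation_single (x : R) : deviation D x 0 0 = 0 := by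
  simp [deviation, hD.map_zero]

theorem deviation_of_map_add {x y : R} (H : D (x + y) = D x + D y) : deviation D x y 0 = 0 := by
  simp only [deviation, hD.map_zero, add_zero, sub_zero]
  grind

/-- The deviation from additivity is compatible with taking commutators. -/
theorem deviation_lie (x y w t : R) :
    ⁅deviation D x y w, t⁆ = deviation D ⁅x, t⁆ ⁅y, t⁆ ⁅w, t⁆ := by
  rw [deviation, deviation, ← lie_add_left, ← lie_add_left, hD, hD, hD, hD]
  simp only [lie_add_left, lie_sub_left]
  abel

end IsLieMulDerivation

/-- A Lie multiplicative derivation `D` for which `D e` commutes with everything, so that `D`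
commutes with `⁅e, ·⁆` and preserves its eigenspaces `e R f`, `f R e` and `e R e + f R f`. -/
structure LiePeirce (e f : R) (D : R → R) : Prop extends PrimePeirce e f where
  lie : IsLieMulDerivation D
  lie_map : ∀ x : R, ⁅D e, x⁆ = 0

namespace LiePeirce

variable {e f : R} {D : R → R} (h : LiePeirce e f D)
include h

theorem lie_map_right (x : R) : ⁅x, D e⁆ = 0 := by
  rw [lie_antisymm, h.lie_map, neg_zero]

theorem map_lie (x : R) : D ⁅x, e⁆ = ⁅D x, e⁆ := by
  rw [h.lie, lie_antisymm x, h.lie_map, neg_zero, add_zero]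

theorem map_lie' (x : R) : D ⁅e, x⁆ = ⁅e, D x⁆ := by
  rw [h.lie, h.lie_map, zero_add]

theorem symm : LiePeirce f e D where
  toPrimePeirce := h.toPrimePeirce.symm
  lie := h.lie
  lie_map x := by
    have := h.lie f x
    rw [h.compl_lie, h.compl_lie, h.map_lie] at this
    grind

theorem map_off {x : R} (hx : InPeirce e f x) : InPeirce e f (D x) := by
  apply h.off_of_lie
  rw [← h.map_lie', h.lie_off hx]

theorem map_diag {x : R} (hx : ⁅x, e⁆ = 0) : ⁅D x, e⁆ = 0 := by
  rw [← h.map_lie, hx, h.lie.map_zero]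

theorem map_neg_off {x : R} (hx : InPeirce e f x) : D (-x) = -D x := by
  rw [← h.off_lie hx, h.map_lie, h.off_lie (h.map_off hx)]

theorem deviation_lie_eq_zero {x y : R} (hx : ⁅x, e⁆ = 0) : ⁅deviation D x y 0, e⁆ = 0 := by
  rw [h.lie.deviation_lie, hx, lie_zero_left, deviation_rotate,
    h.lie.deviation_single]

/-- The commutator with `c` is off-diagonal, since the deviation is diagonal; but by
`deviation_lie` it is itself the deviation of an element of `f R e` and a diagonal one, hence
diagonal. -/
theorem deviation_lie_off_rev {x y c : R} (hx : ⁅x, e⁆ = 0) (hy : InPeirce e f y)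
    (hc : InPeirce f e c) : ⁅deviation D x y 0, c⁆ = 0 := by
  have h1 := h.diag_lie_off_rev (h.deviation_lie_eq_zero (y := y) hx) hc
  rw [← h.off_rev_lie h1, h.lie.deviation_lie, lie_zero_left, deviation_swap]
  exact h.deviation_lie_eq_zero (h.off_lie_off_rev hy hc)

/-- Additivity of `D` across the two off-diagonal components comes from expanding `⁅e + x, e + y⁆`.
The deviations of `D` on `e + x` and `e + y` are not yet known to be central, but they commute with
`y` and `x` respectively, which is all the expansion needs. -/
theorem map_off_add_off {x y : R} (hx : InPeirce e f x) (hy : InPeirce f e y) :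
    D (x + y) = D x + D y := by
  have key {x : R} (hx : InPeirce e f x) : D (-x + y) = -D x + D y := by
    set z := deviation D e x 0 with hz
    set z' := deviation D e y 0 with hz'
    have hee : ⁅e, e⁆ = 0 := lie_self_eq e
    have hze : ⁅z, e⁆ = 0 := h.deviation_lie_eq_zero hee
    have hze' : ⁅z', e⁆ = 0 := h.deviation_lie_eq_zero hee
    have hzy : ⁅z, y⁆ = 0 := h.deviation_lie_off_rev hee hx hy
    have hxz : ⁅z', x⁆ = 0 :=
      h.symm.deviation_lie_off_rev (h.lie_compl_eq_zero hee) hy hx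
    have hDx : D (e + x) = D e + D x + z := by
      simp only [hz, deviation, h.lie.map_zero, add_zero]; abel
    have hDy : D (e + y) = D e + D y + z' := by
      simp only [hz', deviation, h.lie.map_zero, add_zero]; abel
    have hxy : ⁅e + x, e + y⁆ = ⁅x, y⁆ - x - y := by
      simp only [lie_add_left, lie_add_right, hee, h.lie_off_rev hy, h.off_lie hx]; abel
    have h1 := h.lie (e + x) (e + y)
    rw [hDx, hDy, hxy] at h1
    simp only [lie_add_left, lie_add_right, h.lie_map, h.lie_map_right, hze, hzy,
      lie_antisymm e z', lie_antisymm x z', hze', hxz, h.lie_off_rev (h.symm.map_off hy),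
        h.off_lie (h.map_off hx)] at h1
    -- Bracketing with `e` removes the diagonal term `D ⁅x, y⁆`.
    have h2 := h.map_lie' (⁅x, y⁆ - x - y)
    have h3 := h.lie x y
    have h4 := h.off_lie_off_rev hx hy
    have h5 := h.map_diag h4
    rw [h1, lie_sub_right, lie_sub_right, lie_antisymm, h4, h.lie_off hx, h.lie_off_rev hy] at h2
    rw [h3, lie_add_left] at h5
    simp only [lie_add_right, lie_neg_right, h.lie_off (h.map_off hx),
      h.lie_off_rev (h.symm.map_off hy), lie_zero_right, neg_zero] at h2
    rw [lie_antisymm e, lie_antisymm e] at h2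
    have h6 : -x + y = 0 - x - -y := by abel
    rw [h6, h2]
    grind
  have := key hx.neg
  rwa [neg_neg, h.map_neg_off hx, neg_neg] at this

theorem deviation_diag_off_mem_center {x y : R} (hx : ⁅x, e⁆ = 0) (hy : InPeirce e f y) :
    deviation D x y 0 ∈ center R := by
  refine h.mem_center_of_diag (h.deviation_lie_eq_zero hx) (fun c hc => ?_)
    (fun c hc => h.deviation_lie_off_rev hx hy hc)
  rw [h.lie.deviation_lie, lie_zero_left]
  exact h.lie.deviation_of_map_add
    (h.map_off_add_off (h.diag_lie_off hx hc) (h.off_lie_off hy hc))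

/-- Additivity of `D` on `e R f`, from expanding `⁅e + x, e + y⁆`. -/
theorem map_add_off {x y : R} (hx : InPeirce e f x) (hy : InPeirce e f y) :
    D (x + y) = D x + D y := by
  have key {x : R} (hx : InPeirce e f x) : D (-x + y) = -D x + D y := by
    have hee : ⁅e, e⁆ = 0 := lie_self_eq e
    have hz := h.deviation_diag_off_mem_center hee hx
    have hz' := h.deviation_diag_off_mem_center hee hy
    set z := deviation D e x 0 with hz
    set z' := deviation D e y 0 with hz'
    have hDx : D (e + x) = D e + D x + z := by
      simp only [hz, deviation, h.lie.map_zero, add_zero]; abel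
    have hDy : D (e + y) = D e + D y + z' := by
      simp only [hz', deviation, h.lie.map_zero, add_zero]; abel
    have hxy : ⁅e + x, e + y⁆ = -x + y + ⁅x, y⁆ := by
      simp only [lie_add_left, lie_add_right, hee, h.lie_off hy, h.off_lie hx]; abel
    have h1 := h.lie (e + x) (e + y)
    rw [hDx, hDy, hxy, h.map_off_add_off (hx.neg.add hy) (h.off_lie_off hx hy), h.lie] at h1
    simp only [lie_add_left, lie_add_right, h.lie_map, h.lie_map_right,
      lie_of_mem_center ‹z ∈ _›, lie_of_mem_center' ‹z' ∈ _›,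
      h.lie_off (h.map_off hy), h.off_lie (h.map_off hx)] at h1
    grind
  have := key hx.neg
  rwa [neg_neg, h.map_neg_off hx, neg_neg] at this

/-- `D` is additive modulo the center on the diagonal. -/
theorem deviation_diag_mem_center {x y : R} (hx : ⁅x, e⁆ = 0) (hy : ⁅y, e⁆ = 0) :
    deviation D x y 0 ∈ center R := by
  refine h.mem_center_of_diag (h.deviation_lie_eq_zero hx) (fun c hc => ?_) (fun c hc => ?_)
  all_goals
    rw [h.lie.deviation_lie, lie_zero_left]
    apply h.lie.deviation_of_map_add
  · exact h.map_add_off (h.diag_lie_off hx hc) (h.diag_lie_off hy hc)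
  · exact h.symm.map_add_off (h.diag_lie_off_rev hx hc) (h.diag_lie_off_rev hy hc)

theorem deviation_lie_eq_zero' {x y w : R} (hx : ⁅x, e⁆ = 0) (hy : InPeirce e f y)
    (hw : InPeirce f e w) : ⁅deviation D x y w, e⁆ = 0 := by
  rw [h.lie.deviation_lie, hx, h.off_lie hy, h.off_rev_lie hw, deviation_rotate]
  exact h.lie.deviation_of_map_add (h.map_off_add_off hy.neg hw)

theorem deviation_lie_off_rev' {x y w c : R} (hx : ⁅x, e⁆ = 0) (hy : InPeirce e f y)
    (hw : InPeirce f e w) (hc : InPeirce f e c) : ⁅deviation D x y w, c⁆ = 0 := by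
  have h1 := h.diag_lie_off_rev (h.deviation_lie_eq_zero' hx hy hw) hc
  rw [← h.off_rev_lie h1, h.lie.deviation_lie, deviation_rotate]
  exact h.deviation_lie_eq_zero' (h.off_lie_off_rev hy hc) (h.symm.off_lie_off hw hc)
    (h.diag_lie_off_rev hx hc)

/-- `D` is additive modulo the center across the diagonal and the two off-diagonal components. -/
theorem deviation_mem_center {x y w : R} (hx : ⁅x, e⁆ = 0) (hy : InPeirce e f y)
    (hw : InPeirce f e w) : deviation D x y w ∈ center R := by
  refine h.mem_center_of_diag (h.deviation_lie_eq_zero' hx hy hw) (fun c hc => ?_)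
    (fun c hc => h.deviation_lie_off_rev' hx hy hw hc)
  have := h.symm.deviation_lie_off_rev' (h.lie_compl_eq_zero hx) hw hy hc
  rwa [← deviation_rotate, deviation_swap] at this

end LiePeirce

/-! ### The graded part is a derivation -/

theorem PeircePair.central_mul_idem {e f z : R} (h : PeircePair e f) (hz : z ∈ center R) :
    InPeirce e e (z * e) := by
  have hc : IsMulCentral z := hz
  constructor
  · rw [(hc.comm e).eq, h.idem_mul_idem_mul]
  · rw [h.mul_idem_mul_idem]

/-- Under the hypothesis on `f R f` components, `D x` is congruent to an element of `e R e` modulo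
the center. -/
theorem LiePeirce.exists_diag_part {e f : R} {D : R → R} (h : LiePeirce e f D)
    (hD : ∀ x, InPeirce e e x → ∃ z ∈ center R, f * D x * f = z * f) {x : R}
    (hx : InPeirce e e x) : ∃ u, InPeirce e e u ∧ D x - u ∈ center R := by
  obtain ⟨a, d, ha, hd, had⟩ := h.exists_diag_of_lie (h.map_diag hx.lie_eq_zero)
  obtain ⟨z, hz, hzf⟩ := hD x hx
  rw [(h.components_unique ha .zero .zero hd (by rw [had]; abel)).2.2.2] at hzf
  refine ⟨a + -(z * e), ha.add (h.central_mul_idem hz).neg, ?_⟩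
  have : D x - (a + -(z * e)) = z := by
    have hz' : z = z * e + z * f := by rw [← mul_add, h.add, mul_one]
    rw [had, hzf]
    grind
  rwa [this]

/-- An additive map `δ` preserving the Peirce components, equal to `D` on the off-diagonal ones
and congruent to `D` modulo the center. -/
structure GradedPart (e f : R) (D : R → R) (δ : R →+ R) : Prop extends LiePeirce e f D where
  diag : ∀ x, InPeirce e e x → InPeirce e e (δ x)
  diag_compl : ∀ x, InPeirce f f x → InPeirce f f (δ x)
  off : ∀ x, InPeirce e f x → δ x = D x
  off_rev : ∀ x, InPeirce f e x → δ x = D x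
  sub_mem : ∀ x, D x - δ x ∈ center R

/-- The diagonal values of the graded part are unique because `e R e` meets the center trivially;
uniqueness turns additivity modulo the center into additivity. -/
theorem LiePeirce.exists_gradedPart {e f : R} {D : R → R} (h : LiePeirce e f D)
    (h₁ : ∀ x, InPeirce e e x → ∃ z ∈ center R, f * D x * f = z * f)
    (h₂ : ∀ x, InPeirce f f x → ∃ z ∈ center R, e * D x * e = z * e) :
    ∃ δ, GradedPart e f D δ := by
  have add_of {e f : R} (h : LiePeirce e f D) {δ : R → R}
      (hδ : ∀ x, InPeirce e e x → InPeirce e e (δ x) ∧ D x - δ x ∈ center R) {x y : R}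
      (hx : InPeirce e e x) (hy : InPeirce e e y) : δ (x + y) = δ x + δ y := by
    have hxy := hx.add hy
    have hm := h.deviation_diag_mem_center hx.lie_eq_zero hy.lie_eq_zero
    rw [deviation, h.lie.map_zero, sub_zero, add_zero] at hm
    have := h.eq_zero_of_central_diag
      (z := (δ (x + y) + -δ x) + -δ y) ?_
      (((hδ _ hxy).1.add (hδ x hx).1.neg).add (hδ y hy).1.neg)
    · grind
    · have := sub_mem_center hm (sub_mem_center (sub_mem_center (hδ _ hxy).2 (hδ x hx).2)
        (hδ y hy).2)
      convert this using 1
      abel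
  have e₁ (x : R) : ∃ u, InPeirce e e x → InPeirce e e u ∧ D x - u ∈ center R := by
    by_cases hx : InPeirce e e x
    · obtain ⟨u, hu⟩ := h.exists_diag_part h₁ hx
      exact ⟨u, fun _ => hu⟩
    · exact ⟨0, fun hx' => absurd hx' hx⟩
  have e₂ (x : R) : ∃ u, InPeirce f f x → InPeirce f f u ∧ D x - u ∈ center R := by
    by_cases hx : InPeirce f f x
    · obtain ⟨u, hu⟩ := h.symm.exists_diag_part h₂ hx
      exact ⟨u, fun _ => hu⟩
    · exact ⟨0, fun hx' => absurd hx' hx⟩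
  choose δ₁ hδ₁ using e₁
  choose δ₂ hδ₂ using e₂
  have a₁ {x y : R} := add_of h hδ₁ (x := x) (y := y)
  have a₂ {x y : R} := add_of h.symm hδ₂ (x := x) (y := y)
  let δ : R →+ R := AddMonoidHom.mk'
    (fun x => δ₁ (e * x * e) + D (e * x * f) + D (f * x * e) + δ₂ (f * x * f)) fun x y => by
      simp only [mul_add, add_mul]
      rw [a₁ (h.component_diag x) (h.component_diag y),
        a₂ (h.symm.component_diag x) (h.symm.component_diag y),
        h.map_add_off (h.component_off x) (h.component_off y),
        h.symm.map_add_off (h.symm.component_off x) (h.symm.component_off y)]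
      abel
  have hδ {a b c d : R} (ha : InPeirce e e a) (hb : InPeirce e f b)
      (hc : InPeirce f e c) (hd : InPeirce f f d) :
      δ (a + b + c + d) = δ₁ a + D b + D c + δ₂ d := by
    obtain ⟨u₁, u₂, u₃, u₄⟩ := h.components_unique ha hb hc hd rfl
    change δ₁ _ + D _ + D _ + δ₂ _ = _
    rw [u₁, u₂, u₃, u₄]
  have z₁ : δ₁ 0 = 0 := by simpa using a₁ .zero .zero
  have z₂ : δ₂ 0 = 0 := by simpa using a₂ .zero .zero
  have z := h.lie.map_zero
  refine ⟨δ,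
    { toLiePeirce := h
      diag := ?_
      diag_compl := ?_
      off := ?_
      off_rev := ?_
      sub_mem := ?_ }⟩
  · intro x hx
    have := hδ hx .zero .zero .zero
    simp only [add_zero, z, z₂] at this
    rw [this]
    exact (hδ₁ x hx).1
  · intro x hx
    have := hδ .zero .zero .zero hx
    simp only [add_zero, zero_add, z, z₁] at this
    rw [this]
    exact (hδ₂ x hx).1
  · intro x hx
    have := hδ .zero hx .zero .zero
    simpa only [add_zero, zero_add, z, z₁, z₂] using this
  · intro x hx
    have := hδ .zero .zero hx .zero
    simpa only [add_zero, zero_add, z, z₁, z₂] using this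
  · intro x
    obtain ⟨a, b, c, d, ha, hb, hc, hd, rfl⟩ := h.exists_components x
    rw [hδ ha hb hc hd]
    have had : ⁅a + d, e⁆ = 0 := by
      rw [lie_add_left, ha.lie_eq_zero, h.diag_compl_lie hd, add_zero]
    have m₁ := h.deviation_mem_center had hb hc
    have m₂ := h.deviation_diag_mem_center ha.lie_eq_zero (h.diag_compl_lie hd)
    rw [deviation, h.lie.map_zero, add_zero, sub_zero] at m₂
    rw [deviation] at m₁
    have := add_mem_center (add_mem_center m₁ m₂)
      (add_mem_center (hδ₁ a ha).2 (hδ₂ d hd).2)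
    convert this using 1
    rw [show a + b + c + d = a + d + b + c by abel]
    abel

namespace GradedPart

variable {e f : R} {D : R → R} {δ : R →+ R} (h : GradedPart e f D δ)
include h

theorem symm : GradedPart f e D δ where
  toLiePeirce := h.toLiePeirce.symm
  diag := h.diag_compl
  diag_compl := h.diag
  off := h.off_rev
  off_rev := h.off
  sub_mem := h.sub_mem

theorem mem_off {x : R} (hx : InPeirce e f x) : InPeirce e f (δ x) := by
  rw [h.off x hx]
  exact h.map_off hx

theorem map_lie_eq (x y : R) : D ⁅x, y⁆ = ⁅δ x, y⁆ + ⁅x, δ y⁆ := by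
  have h1 : ⁅D x, y⁆ = ⁅δ x, y⁆ := by
    rw [← sub_eq_zero, ← lie_sub_left, lie_of_mem_center (h.sub_mem x)]
  have h2 : ⁅x, D y⁆ = ⁅x, δ y⁆ := by
    rw [← sub_eq_zero, ← lie_sub_right, lie_of_mem_center' (h.sub_mem y)]
  rw [h.lie, h1, h2]

theorem map_diag_mul_off {x y : R} (hx : InPeirce e e x) (hy : InPeirce e f y) :
    δ (x * y) = δ x * y + x * δ y := by
  have h1 := h.map_lie_eq x y
  simp only [Ring.lie_def] at h1
  rw [h.off_mul_diag_left hy hx, h.off_mul_diag_left hy (h.diag x hx),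
    h.off_mul_diag_left (h.mem_off hy) hx, sub_zero, sub_zero, sub_zero] at h1
  rw [h.off _ (h.diag_mul_off hx hy), h1]

theorem map_off_mul_diag {x y : R} (hx : InPeirce e f x) (hy : InPeirce f f y) :
    δ (x * y) = δ x * y + x * δ y := by
  have h1 := h.map_lie_eq x y
  simp only [Ring.lie_def] at h1
  rw [h.toPeircePair.symm.diag_mul_off_rev hy hx,
    h.toPeircePair.symm.diag_mul_off_rev (h.diag_compl y hy) hx,
    h.toPeircePair.symm.diag_mul_off_rev hy (h.mem_off hx), sub_zero, sub_zero, sub_zero] at h1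
  rw [h.off _ (h.off_mul_diag hx hy), h1]

theorem map_off_mul_off {x y : R} (hx : InPeirce e f x) (hy : InPeirce e f y) :
    δ (x * y) = δ x * y + x * δ y := by
  have h1 := h.map_lie_eq x y
  rw [← h.off_rev _ (h.off_lie_off hx hy)] at h1
  simp only [Ring.lie_def] at h1
  rw [h.off_mul_comm hy hx, h.off_mul_comm hy (h.mem_off hx),
    h.off_mul_comm (h.mem_off hy) hx] at h1
  simp only [sub_neg_eq_add, map_add] at h1
  rw [← sub_eq_zero]
  apply h.two
  grind

/-- Both sides agree after right multiplication by `e R f`, on which `e R e` acts faithfully. -/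
theorem map_diag_mul_diag {x y : R} (hx : InPeirce e e x) (hy : InPeirce e e y) :
    δ (x * y) = δ x * y + x * δ y := by
  have hx' := h.diag x hx
  have hy' := h.diag y hy
  have hxy := h.diag_mul_diag hx hy
  have := h.diag_eq_zero h.prime h.left_ne h.right_ne (u := δ (x * y) + -(δ x * y + x * δ y))
    ((h.diag _ hxy).add
      ((h.diag_mul_diag hx' hy).add (h.diag_mul_diag hx hy')).neg) fun c hc => ?_
  · grind
  · have hc' := h.mem_off hc
    have hyc := h.diag_mul_off hy hc
    have h1 := h.map_diag_mul_off hxy hc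
    rw [h.diag_assoc_off hx hy hc, h.map_diag_mul_off hx hyc, h.map_diag_mul_off hy hc,
      h.diag_assoc_off hx hy hc'] at h1
    simp only [add_mul, neg_mul]
    rw [h.diag_assoc_off hx' hy hc, h.diag_assoc_off hx hy' hc]
    rw [mul_add] at h1
    grind

/-- The defects `u` of `x * y` and `v` of `y * x` have a central difference `z`. Comparing the two
values of `δ` on `(x * y) * x = x * (y * x)` gives `2 (z x) = 0`, so that `z = 0` or `x = 0`. -/
theorem map_off_mul_off_rev {x y : R} (hx : InPeirce e f x) (hy : InPeirce f e y) :
    δ (x * y) = δ x * y + x * δ y := by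
  have hx' := h.mem_off hx
  have hy' := h.symm.mem_off hy
  have hxy := h.off_mul_off_rev hx hy
  have hyx := h.toPeircePair.symm.off_mul_off_rev hy hx
  obtain ⟨u, hu⟩ : ∃ u, u = δ (x * y) + -(δ x * y + x * δ y) := ⟨_, rfl⟩
  obtain ⟨v, hv⟩ : ∃ v, v = δ (y * x) + -(δ y * x + y * δ x) := ⟨_, rfl⟩
  have hum : InPeirce e e u := by
    rw [hu]
    exact (h.diag _ hxy).add ((h.off_mul_off_rev hx' hy).add (h.off_mul_off_rev hx hy')).neg
  have hvm : InPeirce f f v := by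
    rw [hv]
    exact (h.diag_compl _ hyx).add ((h.toPeircePair.symm.off_mul_off_rev hy' hx).add
      (h.toPeircePair.symm.off_mul_off_rev hy hx')).neg
  have hz : u - v ∈ center R := by
    have h1 := h.sub_mem ⁅x, y⁆
    rw [h.map_lie_eq] at h1
    convert neg_mem_center h1 using 1
    rw [hu, hv]
    simp only [Ring.lie_def, map_sub]
    abel
  have hvx : v * x = 0 := h.toPeircePair.symm.diag_mul_off_rev hvm hx
  have hxu : x * u = 0 := h.off_mul_diag_left hx hum
  have hcomm : u * x = -(x * v) := by
    have := lie_of_mem_center hz x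
    rw [Ring.lie_def, sub_mul, mul_sub, hvx, hxu] at this
    grind
  have hflex : u * x = x * v := by
    have h1 := h.map_diag_mul_off hxy hx
    have h2 := h.map_off_mul_diag hx hyx
    have h3 := h.alt.flexible x y
    have h4 := h.alt.flexible x (δ y)
    have h5 := h.alt.swap_outer (δ x) y x
    simp only [associator] at h3 h4 h5
    rw [sub_eq_zero.1 h3] at h1
    rw [hu, hv]
    simp only [add_mul, mul_add, mul_neg, neg_mul]
    grind
  have hux : u * x = 0 := by
    apply h.two
    grind
  by_cases hzero : u - v = 0
  · have huv := sub_eq_zero.1 hzero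
    have : u = 0 := h.eq_zero_of_left hum (huv ▸ hvm)
    grind
  · have : x = 0 := h.eq_zero_of_central_mul hz hzero (by rw [sub_mul, hux, hvx, sub_zero])
    rw [this]
    simp

theorem map_mul (x y : R) : δ (x * y) = δ x * y + x * δ y := by
  obtain ⟨a, b, c, d, ha, hb, hc, hd, rfl⟩ := h.exists_components x
  obtain ⟨a', b', c', d', ha', hb', hc', hd', rfl⟩ := h.exists_components y
  have l := h.mul_sum (h.diag a ha) (h.mem_off hb) (h.symm.mem_off hc) (h.symm.diag d hd)
    ha' hb' hc' hd'
  have r := h.mul_sum ha hb hc hd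
    (h.diag _ ha') (h.mem_off hb') (h.symm.mem_off hc') (h.symm.diag _ hd')
  rw [h.mul_sum ha hb hc hd ha' hb' hc' hd']
  simp only [map_add]
  rw [l, r, h.map_diag_mul_diag ha ha', h.map_off_mul_off_rev hb hc', h.map_diag_mul_off ha hb',
    h.map_off_mul_diag hb hd', h.symm.map_off_mul_off hc hc', h.symm.map_off_mul_diag hc ha',
    h.symm.map_diag_mul_off hd hc', h.map_off_mul_off hb hb', h.symm.map_off_mul_off_rev hc hb',
    h.symm.map_diag_mul_diag hd hd']
  abel

end GradedPart

/-! ### Normalization by an inner derivation -/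

namespace PeircePair

variable {e f : R} (h : PeircePair e f)
include h

theorem compl_mul_diag_mul {x : R} (hx : InPeirce e e x) (y : R) : f * (x * y) = 0 := by
  have hxf : x * f = 0 := h.right_zero hx
  have hfy : x * (f * y) = 0 := by
    apply h.mul_eq_zero_of_left hx
    rw [h.compl, sub_mul, one_mul, mul_sub, h.idem_mul_idem_mul, sub_self]
  rw [h.symm.idem_mul_mul, h.left_zero hx, hxf, hfy]
  simp

/-- A derivation maps `e R e` to elements without `f R f` component. -/
theorem derivation_component {δ : R → R} (hδ : ∀ x y, δ (x * y) = δ x * y + x * δ y) {x : R}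
    (hx : InPeirce e e x) : f * δ x * f = 0 := by
  have h1 : f * (δ x * e) * f = 0 := by
    rw [h.symm.idem_mul_assoc, h.compl, mul_sub, mul_one, h.mul_idem_mul_idem, sub_self, mul_zero]
  have h2 := hδ x e
  rw [hx.right] at h2
  rw [h2, mul_add, add_mul, h1, h.compl_mul_diag_mul hx, zero_mul, add_zero]

theorem central_component {z : R} (hz : z ∈ center R) : f * z * f = z * f := by
  have hc : IsMulCentral z := hz
  rw [← (hc.comm f).eq, h.symm.mul_idem_mul_idem]

theorem mem_peirce {x : R} : x ∈ peirce e e ↔ InPeirce e e x := by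
  constructor
  · rintro ⟨a, rfl⟩
    exact h.component_diag a
  · intro hx
    exact ⟨x, by rw [hx.left, hx.right]⟩

theorem image_subset_iff {D : R → R} :
    (fun a => (f * D a) * f) '' peirce e e ⊆ (fun z => z * f) '' center R ↔
      ∀ x, InPeirce e e x → ∃ z ∈ center R, f * D x * f = z * f := by
  constructor
  · intro H x hx
    obtain ⟨z, hz, hzx⟩ := H ⟨x, h.mem_peirce.2 hx, rfl⟩
    exact ⟨z, hz, hzx.symm⟩
  · rintro H _ ⟨x, hx, rfl⟩
    obtain ⟨z, hz, hzx⟩ := H x (h.mem_peirce.1 hx)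
    exact ⟨z, hz, hzx.symm⟩

end PeircePair

theorem IsDerivationPlusCentral.component {e f : R} (h : PeircePair e f) {D : R → R}
    (hD : IsDerivationPlusCentral D) {x : R} (hx : InPeirce e e x) :
    ∃ z ∈ center R, f * D x * f = z * f := by
  obtain ⟨δ, τ, hδ, hτ, -, hsum⟩ := hD
  refine ⟨τ x, hτ x, ?_⟩
  rw [hsum, mul_add, add_mul, h.derivation_component hδ hx, zero_add, h.central_component (hτ x)]

/-- Subtracting a derivation from a Lie multiplicative derivation leaves one. -/
theorem IsLieMulDerivation.sub_derivation {D : R → R} (hD : IsLieMulDerivation D) {d : R →+ R}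
    (hd : ∀ x y, d (x * y) = d x * y + x * d y) : IsLieMulDerivation fun x => D x - d x := by
  intro x y
  have : d ⁅x, y⁆ = ⁅d x, y⁆ + ⁅x, d y⁆ := by
    simp only [Ring.lie_def, map_sub, hd]
    abel
  simp only [hD x y, this, lie_sub_left, lie_sub_right]
  abel

/-- Comparison of `e R f` components in `p = ⁅a, x⁆ + ⁅e, p⁆`: the terms `e * p * f` cancel. -/
theorem PeircePair.lie_eq_zero_of_eq {e f a₁ a₂ a₃ a₄ x p : R} (h : PeircePair e f)
    (h₁ : InPeirce e e a₁) (h₂ : InPeirce e f a₂) (h₃ : InPeirce f e a₃) (h₄ : InPeirce f f a₄)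
    (hx : InPeirce e f x) (hp : p = ⁅a₁ + a₂ + a₃ + a₄, x⁆ + ⁅e, p⁆) : ⁅a₁ + a₄, x⁆ = 0 := by
  rw [← h.lie_off_component h₁ h₂ h₃ h₄ hx]
  have h5 : e * ⁅e, p⁆ * f = e * p * f := by
    have : p * e * f = 0 := by
      rw [h.compl, mul_sub, mul_one, h.mul_idem_mul_idem, sub_self]
    rw [Ring.lie_def, mul_sub, sub_mul, h.idem_mul_idem_mul, h.idem_mul_assoc_compl (p * e), this,
      mul_zero, sub_zero]
  have h6 := congrArg (fun q => e * q * f) hp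
  simp only [mul_add, add_mul] at h6 ⊢
  rw [h5] at h6
  simp only [lie_add_left, mul_add, add_mul] at h6 ⊢
  grind

/-- After subtracting an inner derivation, a Lie multiplicative derivation sends the idempotent
to the center. -/
theorem PrimePeirce.exists_sub_derivation {e f : R} (h : PrimePeirce e f) {D : R → R}
    (hD : IsLieMulDerivation D) : ∃ d : R →+ R, (∀ x y, d (x * y) = d x * y + x * d y) ∧
      LiePeirce e f fun x => D x - d x := by
  obtain ⟨a₁, a₂, a₃, a₄, h₁, h₂, h₃, h₄, ha⟩ := h.exists_components (D e)
  have hcen : a₁ + a₄ ∈ center R := by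
    refine h.mem_center_of_diag ?_ (fun x hx => ?_) (fun x hx => ?_)
    · rw [lie_add_left, h₁.lie_eq_zero, h.diag_compl_lie h₄, add_zero]
    · apply h.lie_eq_zero_of_eq (p := D x) h₁ h₂ h₃ h₄ hx
      rw [← ha, ← hD, h.lie_off hx]
    · have := h.toPeircePair.symm.lie_eq_zero_of_eq (p := D x) h₄.neg h₃.neg h₂.neg h₁.neg hx ?_
      · rw [← neg_add, lie_neg_left, neg_eq_zero] at this
        rwa [add_comm]
      · rw [h.compl_lie, show -a₄ + -a₃ + -a₂ + -a₁ = -D e by rw [ha]; abel, lie_neg_left,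
          ← lie_antisymm, add_comm, ← hD, h.off_rev_lie hx]
  have hd := h.alt.innerMap_mul (a₂ + a₃) e
  refine ⟨innerMap (a₂ + a₃) e, hd,
    { toPrimePeirce := h
      lie := hD.sub_derivation hd
      lie_map := ?_ }⟩
  have hde : innerMap (a₂ + a₃) e e = a₂ + a₃ := by
    rw [innerMap_apply, (h.alt e _).2, smul_zero, sub_zero, lie_add_left, h.off_lie h₂,
      h.off_rev_lie h₃, lie_add_left, lie_neg_left, h.off_lie h₂, h.off_rev_lie h₃, neg_neg]
  intro x
  rw [hde, ha, show a₁ + a₂ + a₃ + a₄ - (a₂ + a₃) = a₁ + a₄ by abel]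
  exact lie_of_mem_center hcen x

theorem PrimePeirce.isDerivationPlusCentral {e f : R} (h : PrimePeirce e f) {D : R → R}
    (hD : IsLieMulDerivation D)
    (h₁ : ∀ x, InPeirce e e x → ∃ z ∈ center R, f * D x * f = z * f)
    (h₂ : ∀ x, InPeirce f f x → ∃ z ∈ center R, e * D x * e = z * e) :
    IsDerivationPlusCentral D := by
  obtain ⟨d, hd, hL⟩ := h.exists_sub_derivation hD
  obtain ⟨δ, hδ⟩ := hL.exists_gradedPart
    (fun x hx => by
      obtain ⟨z, hz, hzx⟩ := h₁ x hx
      exact ⟨z, hz, by rw [mul_sub, sub_mul, h.derivation_component hd hx, sub_zero, hzx]⟩)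
    (fun x hx => by
      obtain ⟨z, hz, hzx⟩ := h₂ x hx
      exact ⟨z, hz, by
        rw [mul_sub, sub_mul, h.toPeircePair.symm.derivation_component hd hx, sub_zero, hzx]⟩)
  refine ⟨δ + d, fun x => D x - d x - δ x, fun x y => ?_, hδ.sub_mem, fun x y => ?_, fun x => ?_⟩
  · simp only [AddMonoidHom.add_apply, hδ.map_mul, hd, add_mul, mul_add]
    abel
  · have h1 := hδ.map_lie_eq x y
    change D ⁅x, y⁆ - d ⁅x, y⁆ - δ ⁅x, y⁆ = 0
    rw [h1]
    simp only [Ring.lie_def, map_sub, hδ.map_mul]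
    abel
  · simp only [AddMonoidHom.add_apply]
    abel

end AltRing

theorem mainTheorem3 {R : Type*} [NonAssocRing R]
    (halt : AltRing.IsAlternative R)
    (htwo : AltRing.TorsionFreeBy 2 R)
    (hthree : AltRing.TorsionFreeBy 3 R)
    (hprime : AltRing.IsPrime R)
    (hcenter : ∀ z ∈ AltRing.center R, z ≠ 0 → ∀ y : R, ∃ x : R, z * x = y)
    (e₁ e₂ : R) (he₁ : AltRing.IsNontrivialIdempotent e₁) (he₂ : e₂ = 1 - e₁)
    (D : R → R) (hD : AltRing.IsLieMulDerivation D) :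
    AltRing.IsDerivationPlusCentral D ↔
      ((fun a => (e₂ * D a) * e₂) '' AltRing.peirce e₁ e₁ ⊆ (fun z => z * e₂) '' AltRing.center R) ∧
      ((fun a => (e₁ * D a) * e₁) '' AltRing.peirce e₂ e₂ ⊆ (fun z => z * e₁) '' AltRing.center R) := by
  have h : AltRing.PrimePeirce e₁ e₂ :=
    { alt := halt
      two := htwo
      idem := he₁.1
      add := by rw [he₂, add_sub_cancel]
      three := hthree
      prime := hprime
      div := hcenter
      left_ne := he₁.2.1
      right_ne := by
        rw [he₂]
        exact sub_ne_zero.2 he₁.2.2.symm }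
  rw [h.image_subset_iff, h.symm.image_subset_iff]
  exact ⟨fun H => ⟨fun _ => H.component h.toPeircePair, fun _ => H.component h.symm.toPeircePair⟩,
    fun H => h.isDerivationPlusCentral hD H.1 H.2⟩
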